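/- Let $D=\{a,b,c\}$ be a three-element set and let $\mathbb{A}$ be an algebra with universe $D$ all of whose operations are finitary and idempotent ($f(x,\ldots,x)=x$). Suppose that the subalgebras of $\mathbb{A}$, apart from the one-element ones and $\mathbb{A}$ itself, are precisely those on $\{a,c\}$ and $\{b,c\}$, and that $\mathbb{A}$ has among its term operations the binary operation $s$ with $s(x,x)=x$ and $s(x,y)=c$ for $x\neq y$ (such an $\mathbb{A}$ is a Gap Algebra). Call $\mathbb{A}$ $\{a,c\}\{b,c\}$-projective if for each $k$-ary term operation $f$ of $\mathbb{A}$ there is a coordinate $i\in\{1,\ldots,k\}$ such that, for all $x_1,\ldots,x_k\in D$, $x_i\in\{a,c\}$ implies $f(x_1,\ldots,x_k)\in\{a,c\}$, and $x_i\in\{b,c\}$ implies $f(x_1,\ldots,x_k)\in\{b,c\}$. Let $\mathrm{Inv}(\mathbb{A})$ be the set of finitary relations on $D$ preserved by all operations of $\mathbb{A}$ and, for a set $\Delta$ of relations, let $\mathrm{Pol}(\Delta)$ be the algebra on $D$ whose operations are all finitary operations preserving every relation in $\Delta$. An algebra $\mathbb{B}$ on $D$ is called $k$-collapsible if for every $m\geq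 k$ there are an idempotent term operation $f$ of $\mathbb{B}$, of some arity $N$, and tuples $B^1,\ldots,B^N$ of $m$ subsets of $D$ each, where every $B^j=(B^j_1,\ldots,B^j_m)$ has exactly $k$ entries equal to $D$ and its other $m-k$ entries equal to $\{x_j\}$ for one $x_j\in D$, such that $f(B^1_i,\ldots,B^N_i)=D$ for every $i\in\{1,\ldots,m\}$, where $f(B^1_i,\ldots,B^N_i)$ denotes $\{f(y_1,\ldots,y_N): y_j\in B^j_i \text{ for all } j\}$. It is collapsible if it is $k$-collapsible for some $k\geq 0$. If $\mathbb{A}$ is not $\{a,c\}\{b,c\}$-projective, then $\mathrm{Pol}(\Delta)$ is collapsible for every finite subset $\Delta$ of $\mathrm{Inv}(\mathbb{A})$. -/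

import Mathlib

universe u

/-- An `n`-ary operation on `D`. -/
abbrev Op (D : Type u) (n : ℕ) : Type u := (Fin n → D) → D

/-- A finitary relation on `D`, together with its arity. -/
abbrev FinRel (D : Type u) : Type u := Σ n : ℕ, Set (Fin n → D)

/-- An algebra with universe `D`, given by its sets of basic operations of each finite arity. -/
abbrev Alg (D : Type u) : Type u := (n : ℕ) → Set (Op D n)

/-- An operation is idempotent if `f (x, …, x) = x` for all `x`. -/
def Op.Idempotent {D : Type u} {n : ℕ} (f : Op D n) : Prop :=
  ∀ x : D, f (fun _ => x) = x

namespace Alg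

variable {D : Type u}

/-- The term operations of an algebra: the least set of operations that contains the projections
and is closed under applying basic operations. -/
inductive IsTermOp (A : Alg D) : {n : ℕ} → Op D n → Prop
  | proj {n : ℕ} (i : Fin n) : IsTermOp A (fun x : Fin n → D => x i)
  | app {k n : ℕ} (f : Op D k) (hf : f ∈ A k) (g : Fin k → Op D n)
      (hg : ∀ j, IsTermOp A (g j)) : IsTermOp A (fun x : Fin n → D => f (fun j => g j x))

/-- An algebra is idempotent if all its basic operations are. -/
def IsIdempotent (A : Alg D) : Prop :=
  ∀ (n : ℕ) (f : Op D n), f ∈ A n → f.Idempotent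

/-- `S` is the domain of a subalgebra: it is closed under all basic operations. -/
def IsSubuniverse (A : Alg D) (S : Set D) : Prop :=
  ∀ (n : ℕ) (f : Op D n), f ∈ A n → ∀ x : Fin n → D, (∀ i, x i ∈ S) → f x ∈ S

open Classical in
/-- The semilattice-without-unit operation on `D` with absorbing element `c`: it maps `(x, x)`
to `x` and every pair off the diagonal to `c`. -/
noncomputable def semilatticeOp (c : D) : Op D 2 :=
  fun x => if x 0 = x 1 then x 0 else c

/-- A Gap Algebra on the three-element set `{a, b, c}`: an idempotent algebra whose subalgebras,
apart from the one-element ones and the algebra itself, are precisely `{a, c}` and `{b, c}`, and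
which has the semilattice-without-unit operation with absorbing element `c` among its (term)
operations. -/
structure IsGapAlgebra (A : Alg D) (a b c : D) : Prop where
  ne_ab : a ≠ b
  ne_ac : a ≠ c
  ne_bc : b ≠ c
  univ_eq : ∀ x : D, x = a ∨ x = b ∨ x = c
  idempotent : A.IsIdempotent
  subalgebras : ∀ S : Set D,
    (A.IsSubuniverse S ∧ S.Nontrivial ∧ S ≠ Set.univ) ↔ (S = {a, c} ∨ S = {b, c})
  semilattice : A.IsTermOp (semilatticeOp c)

/-- `A` is `αβ`-projective: every operation `f` of `A` has a coordinate `i` such that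
`x i ∈ α` forces `f x ∈ α` and `x i ∈ β` forces `f x ∈ β`. -/
def IsProjective (A : Alg D) (α β : Set D) : Prop :=
  ∀ (k : ℕ) (f : Op D k), A.IsTermOp f →
    ∃ i : Fin k, ∀ x : Fin k → D, (x i ∈ α → f x ∈ α) ∧ (x i ∈ β → f x ∈ β)

end Alg

/-- `f` preserves `ρ`: applying `f` coordinatewise to tuples of `ρ` gives a tuple of `ρ`. -/
def Op.Preserves {D : Type u} {k : ℕ} (f : Op D k) (ρ : FinRel D) : Prop :=
  ∀ t : Fin k → Fin ρ.1 → D, (∀ j, t j ∈ ρ.2) → (fun i => f (fun j => t j i)) ∈ ρ.2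

/-- `Inv(A)`: the finitary relations preserved by all operations of `A`. -/
def invRel {D : Type u} (A : Alg D) : Set (FinRel D) :=
  {ρ | ∀ (k : ℕ) (f : Op D k), f ∈ A k → f.Preserves ρ}

/-- `Pol(Δ)`: the algebra of all finitary operations that preserve every relation in `Δ`. -/
def polAlg {D : Type u} (Δ : Set (FinRel D)) : Alg D :=
  fun _ => {f | ∀ ρ ∈ Δ, f.Preserves ρ}

/-- An `m`-ary adversary over `D`: an `m`-tuple of subsets of `D`. -/
abbrev Adversary (D : Type u) (m : ℕ) : Type u := Fin m → Set D

/-- The adversary `T` is `f`-composable from the adversaries `B 0, …, B (k - 1)`: in every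
coordinate `i`, the image `f (B 0 i, …, B (k - 1) i)` contains `T i`. -/
def Adversary.Composable {D : Type u} {m k : ℕ} (T : Adversary D m) (f : Op D k)
    (B : Fin k → Adversary D m) : Prop :=
  ∀ i : Fin m, T i ⊆ f '' {x | ∀ j, x j ∈ B j i}

open Classical in
/-- The adversaries of length `m` that are `D` in exactly `k` coordinates and `{x}` in the other
`m - k` coordinates. -/
def collapsings (D : Type u) (m k : ℕ) (x : D) : Set (Adversary D m) :=
  {B | ∃ S : Finset (Fin m), S.card = k ∧ ∀ i, B i = if i ∈ S then Set.univ else {x}}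

namespace Alg

variable {D : Type u}

/-- `A` is `k`-collapsible from source `X`: for every length `m ≥ k`, the full adversary
`(D, …, D)` is `f`-composable from members of `⋃ x ∈ X, collapsings D m k x`, for some
idempotent term operation `f` of `A`. -/
def IsKCollapsibleFrom (A : Alg D) (k : ℕ) (X : Set D) : Prop :=
  ∀ m : ℕ, k ≤ m → ∃ (N : ℕ) (f : Op D N) (B : Fin N → Adversary D m),
    A.IsTermOp f ∧ f.Idempotent ∧ (∀ j, B j ∈ ⋃ x ∈ X, collapsings D m k x) ∧
      Adversary.Composable (fun _ => Set.univ) f B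

/-- `A` is collapsible: `k`-collapsible, from the whole of `D` as source, for some `k`. -/
def IsCollapsible (A : Alg D) : Prop :=
  ∃ k : ℕ, A.IsKCollapsibleFrom k Set.univ

end Alg

/-! Non-projectivity gives a term operation `f` with no coordinate decisive for both `a` and `b`.
Take as columns all tuples over two copies of the `m` coordinates that are constantly `a` or
constantly `b` off `k` coordinates. It suffices to find `h` in `idemPol Δ` that sends these columns
to the target that is `a` on one copy and `b` on the other. The meet of two copies of `h` with
independent arguments then attains `a`, `b` and, as the meet of `a` and `b`, also `c` in every
coordinate.

Consider the tuples realised from the columns. If `f` lacks a coordinate decisive for `b` or one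
decisive for `a`, every tuple is realised (`mem_of_no_decisive`). The same holds if a meet relation
is invariant (`HasMeetRel.exists_tight_row`, `mem_of_tight_row`). Otherwise a value forced by a
small set of positions is already forced by one of them (`Forces.exists_singleton`). So `h` can be
defined argument by argument: the value forced by some position of the target, and `c` if there is
none. On few arguments `h` agrees with a member of `idemPol Δ`. Since the arities in `Δ` are
bounded, this puts `h` itself there (`mem_idemPol_of_local`). -/

section Abstract

open Classical in
/-- The binary operation with `x * x = x` and `x * y = c` for `x ≠ y`. -/
noncomputable def flatMeet {D : Type*} (c x y : D) : D := if x = y then x else c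

variable {D V X : Type*} {a b c : D} {n : ℕ} {f : Op D n}

@[simp] theorem flatMeet_self (c x : D) : flatMeet c x x = x := by simp [flatMeet]

theorem flatMeet_of_ne (c : D) {x y : D} (h : x ≠ y) : flatMeet c x y = c := by simp [flatMeet, h]

@[simp] theorem flatMeet_left (c x : D) : flatMeet c c x = c := by simp [flatMeet]

theorem flatMeet_ne (hbc : b ≠ c) {x y : D} (h : x ≠ b ∨ y ≠ b) : flatMeet c x y ≠ b := by
  unfold flatMeet
  split_ifs with hxy
  · subst hxy; simpa using h
  · exact hbc.symm

/-- `a`, `b`, `c` are the three distinct elements of `D`. -/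
structure IsTriple (a b c : D) : Prop where
  ne_ab : a ≠ b
  ne_ac : a ≠ c
  ne_bc : b ≠ c
  cover : ∀ x : D, x = a ∨ x = b ∨ x = c

theorem IsTriple.swap (h : IsTriple a b c) : IsTriple b a c :=
  ⟨h.ne_ab.symm, h.ne_bc, h.ne_ac, fun x => by have := h.cover x; tauto⟩

/-- `G` is closed under the pointwise action of `flatMeet c` and `f`. -/
structure IsClosedUnder (c : D) (f : Op D n) (G : Set (V → D)) : Prop where
  meet : ∀ g ∈ G, ∀ g' ∈ G, (fun v => flatMeet c (g v) (g' v)) ∈ G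
  app : ∀ t : Fin n → V → D, (∀ j, t j ∈ G) → (fun v => f (fun j => t j v)) ∈ G

/-- The coordinate `i` of `f` is decisive for `b`: the value `b` requires the entry `b` at `i`. -/
def IsDecisive (f : Op D n) (b : D) (i : Fin n) : Prop := ∀ x, f x = b → x i = b

/-- No coordinate is decisive for both `a` and `b`. -/
def NoCommonDecisive (f : Op D n) (a b : D) : Prop :=
  ∀ i, ¬ (IsDecisive f a i ∧ IsDecisive f b i)

theorem NoCommonDecisive.swap (h : NoCommonDecisive f a b) : NoCommonDecisive f b a :=
  fun i hi => h i hi.symm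

theorem NoCommonDecisive.exists_witness (h : NoCommonDecisive f a b) {i : Fin n}
    (hi : IsDecisive f b i) : ∃ r, f r = a ∧ r i ≠ a := by
  by_contra! hc
  exact h i ⟨hc, hi⟩

/-- The tuples realised by `G` along `x`. -/
def realised (G : Set (V → D)) (x : X → V) : Set (X → D) := {u | ∃ g ∈ G, ∀ v, g (x v) = u v}

theorem IsClosedUnder.realised {G : Set (V → D)} (hG : IsClosedUnder c f G) (x : X → V) :
    IsClosedUnder c f (realised G x) := by
  constructor
  · rintro u ⟨g, hg, hu⟩ u' ⟨g', hg', hu'⟩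
    exact ⟨_, hG.meet g hg g' hg', fun v => by simp [hu, hu']⟩
  · intro t ht
    choose g hg hgt using ht
    exact ⟨_, hG.app g hg, fun v => by simp [hgt]⟩

/-! ### Generating all tuples from nearly constant ones -/

/-- If every tuple with few entries different from `a` lies in `Γ`, so does every tuple with few
entries `b`. -/
theorem mem_of_card_eq_le [Fintype X] (hD : IsTriple a b c) {Γ : Set (X → D)}
    (hΓ : IsClosedUnder c f Γ) {K : ℕ}
    (hfree : ∀ u : X → D, {v | u v ≠ a}.ncard ≤ K + 1 → u ∈ Γ) (u : X → D)
    (hu : {v | u v = b}.ncard ≤ K) : u ∈ Γ := by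
  classical
  induction hN : {v | u v = c}.ncard generalizing u with
  | zero =>
    apply hfree
    rw [Set.ncard_eq_zero] at hN
    refine le_trans (Set.ncard_le_ncard (fun v hv => ?_)) (hu.trans (Nat.le_succ _))
    have h1 : v ∉ {v | u v = c} := by simp [hN]
    have := hD.cover (u v)
    simp only [Set.mem_ofPred_eq] at *
    tauto
  | succ N ih =>
    obtain ⟨w, hw⟩ : {v | u v = c}.Nonempty := by
      rw [Set.nonempty_iff_ne_empty]; intro h; simp [h] at hN
    have hw' : u w = c := hw
    have h1 : Function.update u w a ∈ Γ := by
      apply ih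
      · refine le_trans (Set.ncard_le_ncard (fun v hv => ?_)) hu
        rcases eq_or_ne v w with rfl | h
        · simp [hD.ne_ab] at hv
        · simpa [h] using hv
      · have : {v | Function.update u w a v = c} = {v | u v = c} \ {w} := by
          ext v
          rcases eq_or_ne v w with rfl | h
          · simp [hD.ne_ac]
          · simp [h]
        rw [this, Set.ncard_sdiff_singleton_of_mem hw, hN]; rfl
    -- Keep only the `c` at `w` and turn the others into `a`: this leaves at most `K` entries `b`
    -- and one `c`, whence `K + 1`. The meet with the previous tuple restores every `c`, since `a`
    -- meets `c` in `c`.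
    have h2 : (fun v => if v = w then c else if u v = c then a else u v) ∈ Γ := by
      apply hfree
      refine le_trans (Set.ncard_le_ncard (t := insert w {v | u v = b}) (fun v hv => ?_))
        ((Set.ncard_insert_le _ _).trans (Nat.succ_le_succ hu))
      by_cases h : v = w
      · exact Or.inl h
      · right
        have := hD.cover (u v)
        simp only [Set.mem_ofPred_eq, h, if_false] at hv ⊢
        split_ifs at hv with h3
        · exact absurd rfl hv
        · tauto
    convert hΓ.meet _ h1 _ h2 using 1
    funext v
    rcases eq_or_ne v w with rfl | h
    · simp [hw', flatMeet_of_ne c hD.ne_ac]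
    · by_cases h3 : u v = c
      · simp [h, h3]
      · simp [h, h3]

/-- If no coordinate of `f` is decisive for `b`, the tuples with few entries different from `a`
generate all tuples. -/
theorem mem_of_no_decisive [Fintype X] (hD : IsTriple a b c) (hf : f.Idempotent)
    (hno : ∀ i, ¬ IsDecisive f b i) {Γ : Set (X → D)} (hΓ : IsClosedUnder c f Γ)
    (hfree : ∀ u : X → D, {v | u v ≠ a}.ncard ≤ n + 1 → u ∈ Γ) (u : X → D) : u ∈ Γ := by
  classical
  induction hN : {v | u v = b}.ncard using Nat.strong_induction_on generalizing u with
  | _ N ih =>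
  by_cases hle : {v | u v = b}.ncard ≤ n
  · exact mem_of_card_eq_le hD hΓ hfree u hle
  obtain ⟨p⟩ : Nonempty (Fin n ↪ {v | u v = b}) := by
    apply Function.Embedding.nonempty_of_card_le
    rw [Fintype.card_fin, ← Nat.card_eq_fintype_card, Nat.card_coe_set_eq]; omega
  have hno' : ∀ i, ∃ x, f x = b ∧ x i ≠ b := fun i => by simpa [IsDecisive] using hno i
  choose r hr hri using hno'
  have hp : ∀ i, u (p i) = b := fun i => (p i).2
  -- Row `p i` is `r i`, so `f` returns `b` there, while column `j` has lost its `b` at `p j`.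
  set w : Fin n → X → D := fun j v => if h : ∃ i, (p i : X) = v then r h.choose j else u v with hw
  have hwp : ∀ i j, w j (p i) = r i j := by
    intro i j
    have h : ∃ i', (p i' : X) = p i := ⟨i, rfl⟩
    have h' : h.choose = i := p.injective (Subtype.ext h.choose_spec)
    simp only [hw, dif_pos h, h']
  have hwn : ∀ j v, (¬ ∃ i, (p i : X) = v) → w j v = u v := by
    intro j v h; simp only [hw, dif_neg h]
  convert hΓ.app w (fun j => ih _ ?_ (w j) rfl) using 1
  · funext v
    by_cases h : ∃ i, (p i : X) = v
    · obtain ⟨i, rfl⟩ := h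
      simp [hwp, hr, hp]
    · simp only [hwn _ v h, hf (u v)]
  · rw [← hN]
    refine Set.ncard_lt_ncard ?_ (Set.toFinite _)
    refine ⟨fun v hv => ?_, fun hsub => ?_⟩
    · by_cases h : ∃ i, (p i : X) = v
      · obtain ⟨i, rfl⟩ := h
        exact hp i
      · simpa [hwn j v h] using hv
    · have := hsub (hp j)
      simp [hwp] at this
      exact hri j this

/-- If `f y = b` and every coordinate at which `y` is `b` fails to be decisive for `a`, then the
tuples with few entries different from `a` and those with few entries different from `b` generate
all tuples. -/
theorem mem_of_tight_row [Fintype X] (hD : IsTriple a b c) (hf : f.Idempotent) {y : Fin n → D}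
    (hy : f y = b) (hya : ∀ j, y j = b → ¬ IsDecisive f a j) {Γ : Set (X → D)}
    (hΓ : IsClosedUnder c f Γ)
    (hfree : ∀ u : X → D, {v | u v ≠ a}.ncard ≤ n + 1 → u ∈ Γ)
    (hfree' : ∀ u : X → D, {v | u v ≠ b}.ncard ≤ n + 1 → u ∈ Γ) (u : X → D) : u ∈ Γ := by
  classical
  induction hN : {v | u v = a}.ncard using Nat.strong_induction_on generalizing u with
  | _ N ih =>
  by_cases hle : {v | u v = a}.ncard ≤ n
  · exact mem_of_card_eq_le hD.swap hΓ hfree' u hle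
  obtain ⟨p⟩ : Nonempty (Fin n ↪ {v | u v = a}) := by
    apply Function.Embedding.nonempty_of_card_le
    rw [Fintype.card_fin, ← Nat.card_eq_fintype_card, Nat.card_coe_set_eq]; omega
  have hr : ∀ i, ∃ x, f x = a ∧ (y i = b → x i ≠ a) := by
    intro i
    by_cases hi : y i = b
    · have := hya i hi
      simp only [IsDecisive, not_forall] at this
      obtain ⟨x, hx, hxi⟩ := this
      exact ⟨x, hx, fun _ => hxi⟩
    · exact ⟨fun _ => a, hf a, fun h => absurd h hi⟩
  choose r hr hri using hr
  have hp : ∀ i, u (p i) = a := fun i => (p i).2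
  -- All `b` positions carry the row `y`. A column with `y j = b` keeps them and loses the `a` at `p
  -- j`; any other column has `b` only among the `n` chosen positions.
  set w : Fin n → X → D := fun j v => if h : ∃ i, (p i : X) = v then r h.choose j else
    if u v = b then y j else u v with hw
  have hwp : ∀ i j, w j (p i) = r i j := by
    intro i j
    have h : ∃ i', (p i' : X) = p i := ⟨i, rfl⟩
    have h' : h.choose = i := p.injective (Subtype.ext h.choose_spec)
    simp only [hw, dif_pos h, h']
  have hwn : ∀ j v, (¬ ∃ i, (p i : X) = v) → w j v = if u v = b then y j else u v := by
    intro j v h; simp only [hw, dif_neg h]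
  have hmem : ∀ j, w j ∈ Γ := by
    intro j
    by_cases hj : y j = b
    · refine ih _ ?_ (w j) rfl
      rw [← hN]
      refine Set.ncard_lt_ncard ?_ (Set.toFinite _)
      refine ⟨fun v hv => ?_, fun hsub => ?_⟩
      · by_cases h : ∃ i, (p i : X) = v
        · obtain ⟨i, rfl⟩ := h
          exact hp i
        · simp only [Set.mem_ofPred_eq, hwn j v h, hj] at hv ⊢
          split_ifs at hv with h3
          · exact absurd hv hD.ne_ab.symm
          · exact hv
      · have := hsub (hp j)
        simp [hwp] at this
        exact hri j hj this
    · apply mem_of_card_eq_le hD hΓ hfree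
      have hsub : {v | w j v = b} ⊆ Set.range (fun i => (p i : X)) := by
        intro v hv
        by_contra h
        have h' : ¬ ∃ i, (p i : X) = v := h
        simp only [Set.mem_ofPred_eq, hwn j v h'] at hv
        split_ifs at hv with h3
        · exact hj hv
        · exact h3 hv
      refine (Set.ncard_le_ncard hsub).trans ?_
      rw [← Set.image_univ]
      refine (Set.ncard_image_le).trans ?_
      simp
  convert hΓ.app w hmem using 1
  funext v
  by_cases h : ∃ i, (p i : X) = v
  · obtain ⟨i, rfl⟩ := h
    simp [hwp, hr, hp]
  · simp only [hwn _ v h]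
    by_cases h3 : u v = b
    · simp [h3, hy]
    · simp [h3, hf (u v)]

/-! ### Forcing and meet relations -/

/-- `u` forces the value `d` at `z`. -/
def Forces (G : Set (V → D)) (x : X → V) (u : X → D) (z : V) (d : D) : Prop :=
  ∀ g ∈ G, (∀ v, g (x v) = u v) → g z = d

/-- Forcing of `b` persists when some entries `a` are changed to `b`. -/
theorem Forces.mono (hD : IsTriple a b c) (hf : f.Idempotent) (hno : NoCommonDecisive f a b)
    {i : Fin n} (hi : IsDecisive f b i) {G : Set (V → D)} (hG : IsClosedUnder c f G) {x : X → V}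
    {u u' : X → D} {z : V} (hu : u ∈ realised G x) (h : Forces G x u z b)
    (huu' : ∀ v, u' v = u v ∨ (u v = a ∧ u' v = b)) : Forces G x u' z b := by
  classical
  intro g' hg' hgu'
  by_contra hz
  obtain ⟨g, hg, hgu⟩ := hu
  have hgz := h g hg hgu
  obtain ⟨r, hr, hri⟩ := hno.exists_witness hi
  -- Positions changed from `a` to `b` see exactly the row `r`, so `f` sends them back to `a` and
  -- the result realises `u`. At `z` the entry in the decisive coordinate `i` comes from `g'` or
  -- from the meet, neither of which is `b`.
  set t : Fin n → V → D := fun j => if r j = a then g else if r j = b then g' else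
    fun v => flatMeet c (g v) (g' v) with ht
  have htG : ∀ j, t j ∈ G := by
    intro j
    simp only [ht]
    split_ifs
    exacts [hg, hg', hG.meet g hg g' hg']
  have key := h _ (hG.app t htG) (fun v => by
    rcases huu' v with hv | ⟨hv, hv'⟩
    · have : ∀ j, t j (x v) = u v := by
        intro j
        simp only [ht]
        split_ifs <;> simp [hgu, hgu', hv]
      simp only [this, hf (u v)]
    · have : ∀ j, t j (x v) = r j := by
        intro j
        simp only [ht]
        rcases hD.cover (r j) with h1 | h1 | h1
        · simp [h1, hgu, hv]
        · simp [h1, hD.ne_ab.symm, hgu', hv']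
        · simp [h1, hD.ne_ac.symm, hD.ne_bc.symm, hgu, hgu', hv, hv', flatMeet_of_ne c hD.ne_ab]
      simp only [this, hr, hv])
  have := hi _ key
  simp only [ht, if_neg hri] at this
  split_ifs at this with h1
  · exact hz this
  · exact flatMeet_ne hD.ne_bc (Or.inr hz) this


/-- There is an invariant ternary relation in which `(b, b)` forces `b` at the third place, while
neither `(a, b)` nor `(b, a)` does. -/
def HasMeetRel (f : Op D n) (a b c : D) : Prop :=
  ∃ R : Set (Fin 3 → D), IsClosedUnder c f R ∧
    (∃ t ∈ R, t 0 = b ∧ t 1 = b) ∧ (∃ t ∈ R, t 0 = a ∧ t 1 = a) ∧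
    (∀ t ∈ R, t 0 = b → t 1 = b → t 2 = b) ∧
    (∃ t ∈ R, t 0 = a ∧ t 1 = b ∧ t 2 ≠ b) ∧ (∃ t ∈ R, t 0 = b ∧ t 1 = a ∧ t 2 ≠ b)

/-- The relation combines two rows with value `b` into a third whose set of `b` coordinates lies in
the intersection of theirs. In a row with fewest `b`s, each such coordinate is therefore decisive
for `b`, hence not for `a`. -/
theorem HasMeetRel.exists_tight_row (hD : IsTriple a b c) (hf : f.Idempotent)
    (hno : NoCommonDecisive f a b) {i : Fin n} (hi : IsDecisive f b i)
    (h : HasMeetRel f a b c) :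
    ∃ y, f y = b ∧ ∀ j, y j = b → ¬ IsDecisive f a j := by
  classical
  obtain ⟨R, hR, ⟨tbb, hbb, hbb0, hbb1⟩, ⟨t0, ht0, ht00, ht01⟩, hforce,
    ⟨tab, hab, hab0, hab1, hab2⟩, ⟨tba, hba, hba0, hba1, hba2⟩⟩ := h
  have hbb2 := hforce _ hbb hbb0 hbb1
  obtain ⟨taa, haa, haa0, haa1, haa2⟩ : ∃ t ∈ R, t 0 = a ∧ t 1 = a ∧ t 2 ≠ b := by
    by_contra! hc
    have hF : Forces R (fun v : Fin 2 => v.castSucc) (fun _ => a) 2 b := fun g hg hga =>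
      hc g hg (hga 0) (hga 1)
    have := hF.mono hD hf hno hi hR (u' := ![a, b])
      ⟨t0, ht0, fun v => by fin_cases v <;> simp [ht00, ht01]⟩
      (fun v => by fin_cases v <;> simp)
    exact hab2 (this tab hab (fun v => by fin_cases v <;> simp [hab0, hab1]))
  -- Entries `c` arise as meets of `a` and `b`; one factor with third entry different from `b` keeps
  -- the meet's third entry different from `b`.
  have hall : ∀ p q, ¬ (p = b ∧ q = b) → ∃ t ∈ R, t 0 = p ∧ t 1 = q ∧ t 2 ≠ b := by
    have hm : ∀ t ∈ R, ∀ t' ∈ R, t' 2 ≠ b → ∃ s ∈ R, s 0 = flatMeet c (t 0) (t' 0) ∧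
        s 1 = flatMeet c (t 1) (t' 1) ∧ s 2 ≠ b := fun t ht t' ht' h2 =>
      ⟨_, hR.meet t ht t' ht', rfl, rfl, flatMeet_ne hD.ne_bc (Or.inr h2)⟩
    have hne := flatMeet_of_ne c hD.ne_ab
    have hne' := flatMeet_of_ne c hD.ne_ab.symm
    have hcb := hm _ hbb _ hab hab2
    have hbc := hm _ hbb _ hba hba2
    have hac := hm _ haa _ hab hab2
    have hca := hm _ haa _ hba hba2
    have hcc := hm _ hbb _ haa haa2
    simp only [hbb0, hbb1, hab0, hab1, hba0, hba1, haa0, haa1, hne, hne', flatMeet_self]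
      at hcb hbc hac hca hcc
    intro p q hpq
    rcases hD.cover p with rfl | rfl | rfl <;> rcases hD.cover q with rfl | rfl | rfl
    · exact ⟨taa, haa, haa0, haa1, haa2⟩
    · exact ⟨tab, hab, hab0, hab1, hab2⟩
    · exact hac
    · exact ⟨tba, hba, hba0, hba1, hba2⟩
    · exact absurd ⟨rfl, rfl⟩ hpq
    · exact hbc
    · exact hca
    · exact hcb
    · exact hcc
  have hpair : ∀ p q, ∃ t ∈ R, t 0 = p ∧ t 1 = q ∧ (t 2 = b → p = b ∧ q = b) := by
    intro p q
    by_cases hpq : p = b ∧ q = b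
    · exact ⟨tbb, hbb, hbb0.trans hpq.1.symm, hbb1.trans hpq.2.symm, fun _ => hpq⟩
    · obtain ⟨t, ht, h0, h1, h2⟩ := hall p q hpq
      exact ⟨t, ht, h0, h1, fun h => absurd h h2⟩
  choose T hT hT0 hT1 hT2 using hpair
  have hcomb : ∀ x x', f x = b → f x' = b → ∃ z, f z = b ∧ ∀ j, z j = b → x j = b ∧ x' j = b := by
    intro x x' hx hx'
    refine ⟨fun j => T (x j) (x' j) 2, ?_, fun j hj => hT2 _ _ hj⟩
    refine hforce _ (hR.app (fun j => T (x j) (x' j)) fun j => hT _ _) ?_ ?_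
    · simpa [hT0] using hx
    · simpa [hT1] using hx'
  set S : Set (Fin n → D) := {y | f y = b} with hS
  have hne : S.Nonempty := ⟨fun _ => b, hf b⟩
  set m : (Fin n → D) → ℕ := fun y => {j | y j = b}.ncard with hm
  set y := Function.argminOn m S hne with hydef
  have hy : f y = b := Function.argminOn_mem m S hne
  refine ⟨y, hy, fun j hj hja => hno j ⟨hja, fun x hx => ?_⟩⟩
  obtain ⟨z, hz, hzj⟩ := hcomb y x hy hx
  have hle : m y ≤ m z := Function.argminOn_le m S (a := z) hz
  have heq : {j | z j = b} = {j | y j = b} :=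
    Set.eq_of_subset_of_ncard_le (fun j hj => (hzj j hj).1) hle
  exact (hzj j (heq.symm ▸ hj : j ∈ {j | z j = b})).2

open Classical in
/-- The tuple that is `b` on `S` and `a` elsewhere. -/
noncomputable def spike (a b : D) (S : Finset X) : X → D := fun v => if v ∈ S then b else a

/-- If `insert v S` forces `b` but neither `S` nor `{v}` does, then fixing `a` elsewhere and
recording the value at `v`, the common value on `S` and the value at `z` gives a meet relation. -/
theorem Forces.exists_singleton (hm : ¬ HasMeetRel f a b c) (hf : f.Idempotent) {G : Set (V → D)}
    (hG : IsClosedUnder c f G) {x : X → V} {z : V} {S : Finset X} (hS : S.Nonempty)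
    (hr : ∀ S' ⊆ S, spike a b S' ∈ realised G x) (h : Forces G x (spike a b S) z b) :
    ∃ v ∈ S, Forces G x (spike a b {v}) z b := by
  classical
  induction hS using Finset.Nonempty.cons_induction with
  | singleton v => exact ⟨v, by simp, h⟩
  | cons v S hv hS ih =>
    by_contra! hc
    have hS' : ¬ Forces G x (spike a b S) z b := fun h' => by
      obtain ⟨w, hw, hw'⟩ := ih (fun S' hS' => hr S' (hS'.trans (Finset.subset_cons hv))) h'
      exact hc w (Finset.mem_cons_of_mem hw) hw'
    have hv' := hc v (Finset.mem_cons_self v S)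
    simp only [Forces, not_forall] at hS' hv'
    obtain ⟨g₁, hg₁, hg₁x, hg₁z⟩ := hS'
    obtain ⟨g₂, hg₂, hg₂x, hg₂z⟩ := hv'
    obtain ⟨g₀, hg₀, hg₀x⟩ := hr ∅ (by simp)
    obtain ⟨g₃, hg₃, hg₃x⟩ := hr _ subset_rfl
    have hne : ∀ w ∈ S, w ≠ v := fun w hw h => hv (h ▸ hw)
    apply hm
    refine ⟨{t | ∃ g ∈ G, (∀ w, w ≠ v → w ∉ S → g (x w) = a) ∧ g (x v) = t 0 ∧
      (∀ w ∈ S, g (x w) = t 1) ∧ g z = t 2}, ⟨?_, ?_⟩, ?_, ?_, ?_, ?_, ?_⟩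
    · rintro t ⟨g, hg, h1, h2, h3, h4⟩ t' ⟨g', hg', h1', h2', h3', h4'⟩
      exact ⟨_, hG.meet g hg g' hg', fun w hw hw' => by simp [h1 w hw hw', h1' w hw hw'],
        by simp [h2, h2'], fun w hw => by simp [h3 w hw, h3' w hw], by simp [h4, h4']⟩
    · intro t ht
      choose g hg h1 h2 h3 h4 using ht
      exact ⟨_, hG.app g hg, fun w hw hw' => by simp [h1 _ w hw hw', hf a],
        by simp [h2], fun w hw => by simp [h3 _ w hw], by simp [h4]⟩
    · exact ⟨![b, b, g₃ z], ⟨g₃, hg₃, fun w hw hw' => by simp [hg₃x, spike, hw, hw'],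
        by simp [hg₃x, spike], fun w hw => by simp [hg₃x, spike, hw], rfl⟩, rfl, rfl⟩
    · exact ⟨![a, a, g₀ z], ⟨g₀, hg₀, fun w hw hw' => by simp [hg₀x, spike],
        by simp [hg₀x, spike], fun w hw => by simp [hg₀x, spike], rfl⟩, rfl, rfl⟩
    · rintro t ⟨g, hg, h1, h2, h3, h4⟩ h0 h1'
      rw [← h4]
      refine h g hg fun w => ?_
      by_cases hw : w = v
      · simp [hw, h2, h0, spike]
      · by_cases hw' : w ∈ S
        · simp [h3 w hw', h1', spike, hw']
        · simp [h1 w hw hw', spike, hw, hw']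
    · exact ⟨![a, b, g₁ z], ⟨g₁, hg₁, fun w hw hw' => by simp [hg₁x, spike, hw'],
        by simp [hg₁x, spike, hv], fun w hw => by simp [hg₁x, spike, hw], rfl⟩, rfl, rfl, hg₁z⟩
    · exact ⟨![b, a, g₂ z], ⟨g₂, hg₂, fun w hw hw' => by simp [hg₂x, spike, hw],
        by simp [hg₂x, spike], fun w hw => by simp [hg₂x, spike, hne w hw], rfl⟩, rfl, rfl, hg₂z⟩

/-! ### Building an operation from forced values -/

theorem spike_mem_realised {G : Set (V → D)} {x : X → V} [Finite X] {k : ℕ}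
    (hfree : ∀ u : X → D, {v | u v ≠ a}.ncard ≤ k → u ∈ realised G x) {S : Finset X}
    (hS : S.card ≤ k) : spike a b S ∈ realised G x := by
  apply hfree
  refine le_trans ?_ hS
  rw [← Set.ncard_coe_finset]
  refine Set.ncard_le_ncard fun v hv => ?_
  by_contra h
  exact hv (if_neg fun h' => h h')

/-- Some position with target `b` forces `b` at `z`. -/
def IsTied (G : Set (V → D)) (x : X → V) (τ : X → D) (a b : D) (z : V) : Prop :=
  ∃ v, τ v = b ∧ Forces G x (spike a b {v}) z b

/-- If already the empty set forces, `Forces.mono` allows adding any position of target `b`; this is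
where `hτ` is needed. -/
theorem IsTied.of_forces (hD : IsTriple a b c) (hf : f.Idempotent) (hno : NoCommonDecisive f a b)
    {i : Fin n} (hi : IsDecisive f b i) (hm : ¬ HasMeetRel f a b c) {G : Set (V → D)}
    (hG : IsClosedUnder c f G) [Finite X] {x : X → V} {k : ℕ}
    (hfree : ∀ u : X → D, {v | u v ≠ a}.ncard ≤ k → u ∈ realised G x) {τ : X → D}
    (hτ : ∃ v, τ v = b) {z : V} {S : Finset X} (hSk : S.card ≤ k) (hS : ∀ v ∈ S, τ v = b)
    (h : Forces G x (spike a b S) z b) : IsTied G x τ a b z := by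
  classical
  rcases S.eq_empty_or_nonempty with rfl | hne
  · obtain ⟨v, hv⟩ := hτ
    refine ⟨v, hv, h.mono hD hf hno hi hG (spike_mem_realised hfree hSk) fun w => ?_⟩
    by_cases hw : w = v <;> simp [spike, hw]
  · obtain ⟨v, hv, hv'⟩ := h.exists_singleton hm hf hG hne fun S' hS' =>
      spike_mem_realised hfree ((Finset.card_le_card hS').trans hSk)
    exact ⟨v, hS v hv, hv'⟩

theorem IsTied.eq_of_realised (hD : IsTriple a b c) (hf : f.Idempotent)
    (hno : NoCommonDecisive f a b) {i : Fin n} (hi : IsDecisive f b i) {G : Set (V → D)}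
    (hG : IsClosedUnder c f G) {x : X → V} {z : V} {v : X}
    (hr : spike a b {v} ∈ realised G x) (h : Forces G x (spike a b {v}) z b) {g : V → D}
    (hg : g ∈ G) (hgx : ∀ w, g (x w) = a ∨ g (x w) = b) (hgv : g (x v) = b) : g z = b := by
  refine h.mono hD hf hno hi hG hr (u' := fun w => g (x w)) (fun w => ?_) g hg fun _ => rfl
  by_cases hw : w = v
  · simp [hw, hgv, spike]
  · simpa [spike, hw, or_comm] using hgx w

/-- For a target that some tuple of `G` need not realise, an operation `h` that attains it and that
agrees with members of `G` on all small sets, when `f` is far from a projection but neither of the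
two meet relations is invariant. -/
theorem exists_local_of_not_hasMeetRel (hD : IsTriple a b c) (hf : f.Idempotent)
    (hno : NoCommonDecisive f a b) {i i' : Fin n} (hi : IsDecisive f b i)
    (hi' : IsDecisive f a i') (hm : ¬ HasMeetRel f a b c) (hm' : ¬ HasMeetRel f b a c)
    {G : Set (V → D)} (hG : IsClosedUnder c f G) [Finite X] {x : X → V} {r k : ℕ} (hrk : r ≤ k)
    (hk : 1 ≤ k)
    (hfree : ∀ u : X → D, {v | u v ≠ a}.ncard ≤ k → u ∈ realised G x)
    (hfree' : ∀ u : X → D, {v | u v ≠ b}.ncard ≤ k → u ∈ realised G x) {τ : X → D}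
    (hτ : ∀ v, τ v = a ∨ τ v = b) (hτa : ∃ v, τ v = a) (hτb : ∃ v, τ v = b) :
    ∃ h : V → D, (∀ v, h (x v) = τ v) ∧
      ∀ F : Finset V, F.card ≤ r → ∃ g ∈ G, ∀ z ∈ F, g z = h z := by
  classical
  have hno' := hno.swap
  have hsp : ∀ v : X, spike a b {v} ∈ realised G x := fun v => spike_mem_realised hfree (by simpa)
  have hsp' : ∀ v : X, spike b a {v} ∈ realised G x := fun v => spike_mem_realised hfree' (by simpa)
  -- The tuple with a single `b` at `v` still has `a` at `w`, so one operation would take both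
  -- forced values at `z`.
  have hexcl : ∀ z, IsTied G x τ a b z → ¬ IsTied G x τ b a z := by
    rintro z ⟨v, hv, hvz⟩ ⟨w, hw, hwz⟩
    have hne : w ≠ v := fun h => hD.ne_ab (hw.symm.trans (h ▸ hv))
    obtain ⟨g, hg, hgx⟩ := hsp v
    have h1 := hvz g hg hgx
    have h2 := IsTied.eq_of_realised hD.swap hf hno' hi' hG (hsp' w) hwz hg
      (fun u => by by_cases hu : u = v <;> simp [hgx, spike, hu]) (by simp [hgx, spike, hne])
    exact hD.ne_ab (h2.symm.trans h1)
  set h : V → D := fun z => if IsTied G x τ a b z then b else if IsTied G x τ b a z then a else c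
    with hh
  have hhb : ∀ z, IsTied G x τ a b z → h z = b := fun z hz => by simp [hh, hz]
  have hha : ∀ z, IsTied G x τ b a z → h z = a := fun z hz => by
    simp [hh, hz, show ¬ IsTied G x τ a b z from fun h' => hexcl z h' hz]
  have hhc : ∀ z, ¬ IsTied G x τ a b z → ¬ IsTied G x τ b a z → h z = c := fun z hz hz' => by
    simp [hh, hz, hz']
  refine ⟨h, fun v => ?_, fun F hF => ?_⟩
  · rcases hτ v with hv | hv
    · rw [hv, hha _ ⟨v, hv, fun g _ hgx => by simp [hgx, spike]⟩]
    · rw [hv, hhb _ ⟨v, hv, fun g _ hgx => by simp [hgx, spike]⟩]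
  -- One witnessing position per tied argument in `F`, hence at most `r` in all.
  have hQ : ∀ (d e : D), ∃ Q : Finset X, Q.card ≤ r ∧ (∀ v ∈ Q, τ v = e) ∧
      ∀ z ∈ F, IsTied G x τ d e z → ∃ v ∈ Q, Forces G x (spike d e {v}) z e := by
    intro d e
    have : ∀ z : {z ∈ F | IsTied G x τ d e z}, ∃ v, τ v = e ∧ Forces G x (spike d e {v}) z e :=
      fun z => (Finset.mem_filter.1 z.2).2
    choose q hq hq' using this
    refine ⟨Finset.univ.image q, ?_, ?_, fun z hz hzt => ?_⟩
    · refine Finset.card_image_le.trans ?_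
      rw [Finset.card_univ, Fintype.card_coe]
      exact (Finset.card_filter_le _ _).trans hF
    · intro v hv
      obtain ⟨z, _, rfl⟩ := Finset.mem_image.1 hv
      exact hq z
    · exact ⟨_, Finset.mem_image_of_mem q (Finset.mem_univ ⟨z, Finset.mem_filter.2 ⟨hz, hzt⟩⟩),
        hq' _⟩
  obtain ⟨Qb, hQbr, hQbτ, hQb⟩ := hQ a b
  obtain ⟨Qa, hQar, hQaτ, hQa⟩ := hQ b a
  have hdisj : ∀ v ∈ Qa, v ∉ Qb := fun v hv hv' =>
    hD.ne_ab ((hQaτ v hv).symm.trans (hQbτ v hv'))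
  have hright : ∀ g ∈ G, (∀ w, g (x w) = a ∨ g (x w) = b) → (∀ v ∈ Qb, g (x v) = b) →
      (∀ v ∈ Qa, g (x v) = a) → ∀ z ∈ F, h z ≠ c → g z = h z := by
    intro g hg hgx hgb hga z hz hzc
    by_cases hzb : IsTied G x τ a b z
    · obtain ⟨v, hv, hvz⟩ := hQb z hz hzb
      rw [hhb z hzb, IsTied.eq_of_realised hD hf hno hi hG (hsp v) hvz hg hgx (hgb v hv)]
    · by_cases hza : IsTied G x τ b a z
      · obtain ⟨v, hv, hvz⟩ := hQa z hz hza
        rw [hha z hza, IsTied.eq_of_realised hD.swap hf hno' hi' hG (hsp' v) hvz hg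
          (fun w => (hgx w).symm) (hga v hv)]
      · exact absurd (hhc z hzb hza) hzc
  have hmax : ∀ g ∈ G, (∀ w, g (x w) = spike a b Qb w) → ∀ z ∈ F, h z ≠ c → g z = h z :=
    fun g hg hgx => hright g hg (fun w => by by_cases hw : w ∈ Qb <;> simp [hgx, spike, hw])
      (fun v hv => by simp [hgx, spike, hv]) (fun v hv => by simp [hgx, spike, hdisj v hv])
  have hmin : ∀ g ∈ G, (∀ w, g (x w) = spike b a Qa w) → ∀ z ∈ F, h z ≠ c → g z = h z :=
    fun g hg hgx => hright g hg (fun w => by by_cases hw : w ∈ Qa <;> simp [hgx, spike, hw])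
      (fun v hv => by simp [hgx, spike, show v ∉ Qa from fun hv' => hdisj v hv' hv])
      (fun v hv => by simp [hgx, spike, hv])
  -- For an untied `z`, one operation avoids `b` and another avoids `a`, both correct on the tied
  -- arguments of `F`. Their meet can only be `c` at `z`.
  have hkill : ∀ z ∈ F, h z = c → ∃ g ∈ G, (∀ y ∈ F, h y ≠ c → g y = h y) ∧ g z = c := by
    intro z hz hzc
    have hzb : ¬ IsTied G x τ a b z := fun h' => hD.ne_bc ((hhb z h').symm.trans hzc)
    have hza : ¬ IsTied G x τ b a z := fun h' => hD.ne_ac ((hha z h').symm.trans hzc)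
    have hFb : ¬ Forces G x (spike a b Qb) z b := fun h' => hzb
      (IsTied.of_forces hD hf hno hi hm hG hfree hτb (hQbr.trans hrk) hQbτ h')
    have hFa : ¬ Forces G x (spike b a Qa) z a := fun h' => hza
      (IsTied.of_forces hD.swap hf hno' hi' hm' hG hfree' hτa (hQar.trans hrk) hQaτ h')
    simp only [Forces, not_forall] at hFa hFb
    obtain ⟨g₁, hg₁, hg₁x, hg₁z⟩ := hFb
    obtain ⟨g₂, hg₂, hg₂x, hg₂z⟩ := hFa
    refine ⟨_, hG.meet g₁ hg₁ g₂ hg₂, fun y hy hyc => ?_, ?_⟩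
    · simp [hmax g₁ hg₁ hg₁x y hy hyc, hmin g₂ hg₂ hg₂x y hy hyc]
    · rcases hD.cover (flatMeet c (g₁ z) (g₂ z)) with h1 | h1 | h1
      · exact absurd h1 (flatMeet_ne hD.ne_ac (Or.inr hg₂z))
      · exact absurd h1 (flatMeet_ne hD.ne_bc (Or.inl hg₁z))
      · exact h1
  have hall : ∀ F' ⊆ F, ∃ g ∈ G, (∀ y ∈ F, h y ≠ c → g y = h y) ∧ ∀ z ∈ F', h z = c → g z = c := by
    intro F'
    induction F' using Finset.induction_on with
    | empty =>
      intro _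
      obtain ⟨g, hg, hgx⟩ := spike_mem_realised hfree (hQbr.trans hrk)
      exact ⟨g, hg, hmax g hg hgx, by simp⟩
    | insert z F' hzF' ih =>
      intro hsub
      obtain ⟨g, hg, hgF, hgc⟩ := ih ((Finset.subset_insert _ _).trans hsub)
      by_cases hzc : h z = c
      · obtain ⟨g', hg', hgF', hgz⟩ := hkill z (hsub (Finset.mem_insert_self _ _)) hzc
        refine ⟨_, hG.meet g hg g' hg', fun y hy hyc => by simp [hgF y hy hyc, hgF' y hy hyc],
          fun y hy hyc => ?_⟩
        rcases Finset.mem_insert.1 hy with rfl | hy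
        · rw [hgz]; unfold flatMeet; split_ifs with h1 <;> simp [*]
        · simp [hgc y hy hyc]
      · refine ⟨g, hg, hgF, fun y hy hyc => ?_⟩
        rcases Finset.mem_insert.1 hy with rfl | hy
        · exact absurd hyc hzc
        · exact hgc y hy hyc
  obtain ⟨g, hg, hgF, hgc⟩ := hall F subset_rfl
  refine ⟨g, hg, fun z hz => ?_⟩
  by_cases hzc : h z = c
  · rw [hgc z hz hzc, hzc]
  · exact hgF z hz hzc

/-- Either every tuple is realised and one member of `G` serves as `h`, or decisive coordinates
exist for both values and a meet relation would, through a tight row, realise everything after all.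
-/
theorem exists_local (hD : IsTriple a b c) (hf : f.Idempotent) (hno : NoCommonDecisive f a b)
    {G : Set (V → D)} (hG : IsClosedUnder c f G) [Finite X] {x : X → V} {r k : ℕ} (hrk : r ≤ k)
    (hnk : n + 1 ≤ k)
    (hfree : ∀ u : X → D, {v | u v ≠ a}.ncard ≤ k → u ∈ realised G x)
    (hfree' : ∀ u : X → D, {v | u v ≠ b}.ncard ≤ k → u ∈ realised G x) {τ : X → D}
    (hτ : ∀ v, τ v = a ∨ τ v = b) (hτa : ∃ v, τ v = a) (hτb : ∃ v, τ v = b) :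
    ∃ h : V → D, (∀ v, h (x v) = τ v) ∧
      ∀ F : Finset V, F.card ≤ r → ∃ g ∈ G, ∀ z ∈ F, g z = h z := by
  have := Fintype.ofFinite X
  have hΓ := hG.realised x
  have hfr : ∀ u : X → D, {v | u v ≠ a}.ncard ≤ n + 1 → u ∈ realised G x :=
    fun u hu => hfree u (hu.trans hnk)
  have hfr' : ∀ u : X → D, {v | u v ≠ b}.ncard ≤ n + 1 → u ∈ realised G x :=
    fun u hu => hfree' u (hu.trans hnk)
  by_cases hall : ∀ u : X → D, u ∈ realised G x
  · obtain ⟨g, hg, hgx⟩ := hall τ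
    exact ⟨g, hgx, fun F _ => ⟨g, hg, fun _ _ => rfl⟩⟩
  obtain ⟨i, hi⟩ : ∃ i, IsDecisive f b i := by
    by_contra! hc
    exact hall (mem_of_no_decisive hD hf hc hΓ hfr)
  obtain ⟨i', hi'⟩ : ∃ i, IsDecisive f a i := by
    by_contra! hc
    exact hall (mem_of_no_decisive hD.swap hf hc hΓ hfr')
  refine exists_local_of_not_hasMeetRel hD hf hno hi hi' (fun hm => ?_) (fun hm => ?_) hG hrk
    (by omega) hfree hfree' hτ hτa hτb
  · obtain ⟨y, hy, hya⟩ := hm.exists_tight_row hD hf hno hi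
    exact hall (mem_of_tight_row hD hf hy hya hΓ hfr hfr')
  · obtain ⟨y, hy, hya⟩ := hm.exists_tight_row hD.swap hf hno.swap hi'
    exact hall (mem_of_tight_row hD.swap hf hy hya hΓ hfr' hfr)

end Abstract

/-! ### From Gap algebras to the abstract setting -/

section Packaging

variable {D : Type u} {a b c : D}

theorem Alg.IsTermOp.idempotent {A : Alg D} (hA : A.IsIdempotent) {n : ℕ} {f : Op D n}
    (hf : A.IsTermOp f) : f.Idempotent := by
  induction hf with
  | proj i => exact fun _ => rfl
  | app f hf g _ ih =>
    intro x
    have : (fun j => g j fun _ => x) = fun _ => x := funext fun j => ih j x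
    simp only [this]
    exact hA _ f hf x

theorem Alg.IsTermOp.preserves {A : Alg D} {ρ : FinRel D} (hρ : ρ ∈ invRel A) {n : ℕ}
    {f : Op D n} (hf : A.IsTermOp f) : f.Preserves ρ := by
  induction hf with
  | proj i => exact fun t ht => ht i
  | app f hf g _ ih => exact fun t ht => hρ _ f hf _ fun j => ih j t ht

theorem semilatticeOp_eq (c x y : D) : Alg.semilatticeOp c ![x, y] = flatMeet c x y := rfl

theorem Alg.IsGapAlgebra.isTriple {A : Alg D} (hA : A.IsGapAlgebra a b c) : IsTriple a b c :=
  ⟨hA.ne_ab, hA.ne_ac, hA.ne_bc, hA.univ_eq⟩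

/-- On three elements, membership in `{a, c}` means being different from `b`, so the projectivity
condition at a coordinate is the contrapositive of decisiveness for both values. -/
theorem Alg.IsGapAlgebra.exists_noCommonDecisive {A : Alg D} (hA : A.IsGapAlgebra a b c)
    (hproj : ¬ A.IsProjective {a, c} {b, c}) :
    ∃ (n : ℕ) (f : Op D n), A.IsTermOp f ∧ NoCommonDecisive f a b := by
  simp only [Alg.IsProjective, not_forall] at hproj
  obtain ⟨n, f, hf, h⟩ := hproj
  refine ⟨n, f, hf, fun i hi => h ⟨i, fun x => ⟨fun hx => ?_, fun hx => ?_⟩⟩⟩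
  · have h1 := hi.2 x
    have := hA.univ_eq (f x)
    have hab := hA.ne_ab
    have hbc := hA.ne_bc
    simp only [Set.mem_insert_iff, Set.mem_singleton_iff] at hx ⊢
    grind
  · have h1 := hi.1 x
    have := hA.univ_eq (f x)
    have hab := hA.ne_ab
    have hac := hA.ne_ac
    simp only [Set.mem_insert_iff, Set.mem_singleton_iff] at hx ⊢
    grind

/-- The idempotent operations with argument places `ι` that preserve every relation in `Δ`. -/
def idemPol (Δ : Set (FinRel D)) (ι : Type*) : Set ((ι → D) → D) :=
  {g | (∀ d, g (fun _ => d) = d) ∧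
    ∀ ρ ∈ Δ, ∀ t : ι → Fin ρ.1 → D, (∀ j, t j ∈ ρ.2) → (fun i => g fun j => t j i) ∈ ρ.2}

theorem idemPol_isClosedUnder {A : Alg D} (hA : A.IsGapAlgebra a b c) {Δ : Set (FinRel D)}
    (hΔ : Δ ⊆ invRel A) {n : ℕ} {f : Op D n} (hf : A.IsTermOp f) (ι : Type*) :
    IsClosedUnder c f (idemPol Δ ι) := by
  constructor
  · rintro g ⟨hg, hgΔ⟩ g' ⟨hg', hgΔ'⟩
    refine ⟨fun d => by simp [hg, hg'], fun ρ hρ t ht => ?_⟩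
    convert hA.semilattice.preserves (hΔ hρ) ![_, _]
      (Fin.forall_fin_two.2 ⟨hgΔ ρ hρ t ht, hgΔ' ρ hρ t ht⟩) using 2 with i
    refine (semilatticeOp_eq c _ _).symm.trans (congrArg _ ?_)
    funext j
    fin_cases j <;> rfl
  · intro t ht
    exact ⟨fun d => by simp only [(ht _).1]; exact hf.idempotent hA.idempotent d,
      fun ρ hρ s hs => hf.preserves (hΔ hρ) _ fun j => (ht j).2 ρ hρ s hs⟩

/-- An operation agreeing with members of `idemPol Δ ι` on all sets of at most `r` arguments is
itself a member, if the relations in `Δ` have arity at most `r`. -/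
theorem mem_idemPol_of_local {Δ : Set (FinRel D)} {ι : Type*} {r : ℕ} (hr : 1 ≤ r)
    (hΔr : ∀ ρ ∈ Δ, ρ.1 ≤ r) {h : (ι → D) → D}
    (hloc : ∀ F : Finset (ι → D), F.card ≤ r → ∃ g ∈ idemPol Δ ι, ∀ z ∈ F, g z = h z) :
    h ∈ idemPol Δ ι := by
  classical
  refine ⟨fun d => ?_, fun ρ hρ t ht => ?_⟩
  · obtain ⟨g, hg, hgh⟩ := hloc {fun _ => d} (by simpa)
    rw [← hgh _ (by simp), hg.1]
  · obtain ⟨g, hg, hgh⟩ := hloc (Finset.univ.image fun i j => t j i)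
      (Finset.card_image_le.trans (by simpa using hΔr ρ hρ))
    convert hg.2 ρ hρ t ht using 2 with i
    exact (hgh _ (Finset.mem_image_of_mem _ (Finset.mem_univ i))).symm

/-- The tuples over `Fin m × Bool` that are constantly `a` or constantly `b` off a set of `k`
elements of `Fin m`. -/
def CollapsedTuple (a b : D) (m k : ℕ) : Type u :=
  {t : Fin m × Bool → D // ∃ S : Finset (Fin m), S.card = k ∧
    ∃ σ, (σ = a ∨ σ = b) ∧ ∀ p, p.1 ∉ S → t p = σ}

theorem exists_collapsedTuple {m k : ℕ} (hkm : k ≤ m) {σ : D} (hσ : σ = a ∨ σ = b)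
    (u : Fin m × Bool → D) (hu : {v | u v ≠ σ}.ncard ≤ k) :
    ∃ t : CollapsedTuple a b m k, t.1 = u := by
  classical
  obtain ⟨S, hS, hSk⟩ := Finset.exists_superset_card_eq
    (s := ({v | u v ≠ σ} : Set (Fin m × Bool)).toFinset.image Prod.fst) (n := k)
    (Finset.card_image_le.trans (by rwa [← Set.ncard_eq_toFinset_card'])) (by simpa)
  refine ⟨⟨u, S, hSk, σ, hσ, fun p hp => ?_⟩, rfl⟩
  by_contra h
  exact hp (hS (Finset.mem_image_of_mem _ (by simpa using h)))

theorem realised_eval {Δ : Set (FinRel D)} {m k : ℕ} (hkm : k ≤ m) {σ : D} (hσ : σ = a ∨ σ = b)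
    (u : Fin m × Bool → D) (hu : {v | u v ≠ σ}.ncard ≤ k) :
    u ∈ realised (idemPol Δ (CollapsedTuple a b m k)) (fun v t => t.1 v) := by
  obtain ⟨t, rfl⟩ := exists_collapsedTuple hkm hσ u hu
  exact ⟨fun y => y t, ⟨fun _ => rfl, fun ρ _ s hs => hs t⟩, fun _ => rfl⟩

end Packaging

/-! ### Collapsibility -/

theorem mainTheorem1 {D : Type u} (a b c : D) (A : Alg D) (hA : A.IsGapAlgebra a b c)
    (hproj : ¬ A.IsProjective {a, c} {b, c})
    (Δ : Set (FinRel D)) (hfin : Δ.Finite) (hΔ : Δ ⊆ invRel A) :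
    (polAlg Δ).IsCollapsible := by
  classical
  obtain ⟨n, f, hf, hno⟩ := hA.exists_noCommonDecisive hproj
  have hD := hA.isTriple
  obtain ⟨r, hr⟩ : ∃ r, ∀ ρ ∈ Δ, ρ.1 ≤ r := by
    obtain ⟨r, hr⟩ := (hfin.image Sigma.fst).bddAbove
    exact ⟨r, fun ρ hρ => hr (Set.mem_image_of_mem _ hρ)⟩
  -- Large enough for locality at `r + 1` arguments and for the `n + 1` exceptional entries used in
  -- generating tuples; being positive, it also makes `Fin m` nonempty. Locality uses `r + 1`
  -- because the idempotence check needs one argument even if `r = 0`.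
  refine ⟨r + n + 1, fun m hm => ?_⟩
  set k := r + n + 1 with hk
  set ι := CollapsedTuple a b m k with hι
  have : Finite D := Set.finite_univ_iff.1 <| (Set.toFinite {a, b, c}).subset fun x _ => by
    simpa using hA.univ_eq x
  have : Finite ι := inferInstanceAs (Finite (Subtype _))
  obtain ⟨h, hhτ, hloc⟩ := exists_local (r := r + 1) (k := k) hD (hf.idempotent hA.idempotent) hno
    (idemPol_isClosedUnder hA hΔ hf ι) (x := fun v t => t.1 v) (by omega) (by omega)
    (realised_eval hm (Or.inl rfl)) (realised_eval hm (Or.inr rfl))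
    (τ := fun v => if v.2 then a else b) (fun v => by cases v.2 <;> simp)
    ⟨(⟨0, by omega⟩, true), rfl⟩ ⟨(⟨0, by omega⟩, false), rfl⟩
  have hh : h ∈ idemPol Δ ι := mem_idemPol_of_local (by omega) (fun ρ hρ => (hr ρ hρ).trans
    (Nat.le_succ r)) hloc
  obtain ⟨N, ⟨e⟩⟩ := Finite.exists_equiv_fin (ι × Bool)
  have hF : (fun y : (ι × Bool) → D => flatMeet c (h fun t => y (t, true))
      (h fun t => y (t, false))) ∈ idemPol Δ (ι × Bool) :=
    (idemPol_isClosedUnder hA hΔ hf (ι × Bool)).meet _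
      ⟨fun d => hh.1 d, fun ρ hρ t ht => hh.2 ρ hρ _ fun j => ht (j, true)⟩ _
      ⟨fun d => hh.1 d, fun ρ hρ t ht => hh.2 ρ hρ _ fun j => ht (j, false)⟩
  choose S hSk σ hσ hS using fun t : ι => t.2
  refine ⟨N, fun y => flatMeet c (h fun t => y (e (t, true))) (h fun t => y (e (t, false))),
    fun j i => if i ∈ S (e.symm j).1 then Set.univ else {σ (e.symm j).1}, ?_, ?_, ?_, ?_⟩
  · refine Alg.IsTermOp.app (A := polAlg Δ) (fun y : Fin N → D => flatMeet c
      (h fun t => y (e (t, true))) (h fun t => y (e (t, false)))) (fun ρ hρ t ht => ?_) _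
      fun j => Alg.IsTermOp.proj j
    exact hF.2 ρ hρ (fun p => t (e p)) fun p => ht _
  · exact fun d => hF.1 d
  · intro j
    simp only [Set.mem_iUnion]
    exact ⟨_, Set.mem_univ _, S (e.symm j).1, hSk _, fun i => rfl⟩
  · intro i d _
    -- Each of the two copies of `h` chooses whether to read the row with target `a` or that with
    -- target `b`.
    obtain ⟨φ, hφ⟩ : ∃ φ : Bool → Bool, flatMeet c (if φ true then a else b)
        (if φ false then a else b) = d := by
      rcases hA.univ_eq d with rfl | rfl | rfl
      · exact ⟨fun _ => true, by simp⟩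
      · exact ⟨fun _ => false, by simp⟩
      · exact ⟨id, by simp [flatMeet_of_ne _ hA.ne_ab]⟩
    refine ⟨fun j => (e.symm j).1.1 (i, φ (e.symm j).2), fun j => ?_, ?_⟩
    · dsimp only
      split_ifs with h1
      · trivial
      · exact hS _ _ h1
    · have h1 := hhτ (i, φ true)
      have h2 := hhτ (i, φ false)
      simp only [Equiv.symm_apply_apply]
      rw [← hφ, ← h1, ← h2]
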